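/- Let $E\in\mathbb R^{n\times n}$ be the prefix-sum matrix ($E_{ij}=1$ if $j\le i$, and $0$ otherwise). For $\gamma\in(0,1)$ put $\tilde c_i=(-1)^i\prod_{j=1}^{i}\frac{\gamma+1-j}{j}$ ($i\ge 0$). For $1\le p\le n$ define $C_\gamma^{(p)}\in\mathbb R^{n\times n}$ through its inverse: $(C_\gamma^{(p)})^{-1}$ is the lower triangular Toeplitz matrix with $(i,j)$ entry $\tilde c_{i-j}$ if $0\le i-j\le p-1$ and $0$ otherwise. Let $B_\gamma^{(p)}=E\,(C_\gamma^{(p)})^{-1}$. For integers $k,b,d\ge 1$ and $C\in\mathbb R^{n\times n}$, let $\mathrm{sens}_{k,b}(C)=\sup\|CG-CG'\|_F$, where the supremum is over all pairs $G,G'\in\mathbb R^{n\times d}$ for which there is a set $S\subseteq\{1,\dots,n\}$ with $|S|\le k$, any two distinct elements of $S$ differing by at least $b$, such that the $i$-th rows of $G$ and $G'$ are equal for $i\notin S$ and differ by a vector of Euclidean norm at most $1$ for $i\in S$. Let $$\mathcal E(B,C)=\frac{\|B\|_F\cdot\mathrm{sens}_{k,b}(C)}{\sqrt n}.$$ There is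 an absolute constant $K>0$ (independent of $\gamma,n,p,k,b,d$) such that for all $\gamma\in(0,1)$ and all integers $n\ge p\ge 2$, $b,d\ge 1$ and $1\le k\le n/b$, the following bounds hold, with $\log$ the natural logarithm. If $0<\gamma<\tfrac12$, then $$\mathcal E(B_\gamma^{(p)},C_\gamma^{(p)})\le K\left(\frac{\sqrt k\,p^{\frac12-\gamma}}{\frac12-\gamma}+\frac1\gamma\sqrt{\frac{nk}{b}}+\sqrt{\frac{kp}{\gamma(\frac12-\gamma)b}}+p^{-\gamma}\sqrt{\frac{nk}{\frac12-\gamma}}\right).$$ If $\gamma=\tfrac12$, then $$\mathcal E(B_\gamma^{(p)},C_\gamma^{(p)})\le K\left(\sqrt k\,\log p+\sqrt{\frac{nk}{b}}+\sqrt{\frac{kp\log p}{b}}+\sqrt{\frac{nk\log p}{p}}\right).$$ If $\tfrac12<\gamma<1$, then $$\mathcal E(B_\gamma^{(p)},C_\gamma^{(p)})\le K\left(\frac{\sqrt k\,p^{\gamma-\frac12}}{(\gamma-\frac12)\sqrt{1-\gamma}}+\sqrt{\frac{nk}{b}}+\frac{\sqrt k\,p^{\gamma}}{(1-\gamma)\sqrt{(\gamma-\frac12)b}}+\sqrt{\frac{(1-\gamma)nk}{(\gamma-\frac12)p}}\right).$$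 -/

import Mathlib

open scoped Matrix

-- `‖M‖` is the Frobenius norm for real matrices.
attribute [local instance] Matrix.frobeniusNormedAddCommGroup

namespace BIFR

noncomputable section

/-- The `n × n` prefix-sum matrix: ones on and below the diagonal, zeros above. -/
def prefixSum (n : ℕ) : Matrix (Fin n) (Fin n) ℝ :=
  Matrix.of fun i j => if j ≤ i then 1 else 0

/-- The generalized binomial coefficient `∏_{j=1}^{i} (γ + 1 - j) / j`. -/
def genBinom (γ : ℝ) (i : ℕ) : ℝ :=
  ∏ j ∈ Finset.Icc 1 i, (γ + 1 - (j : ℝ)) / (j : ℝ)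

/-- The coefficients `(-1)^i * binom(γ, i)` of the power series of `(1 - x)^γ`. -/
def cTilde (γ : ℝ) (i : ℕ) : ℝ := (-1) ^ i * genBinom γ i

/-- The banded lower triangular Toeplitz matrix whose first `p` diagonals (the main diagonal
included) carry `cTilde γ 0 = 1, cTilde γ 1, …, cTilde γ (p - 1)`, all other entries being `0`. -/
def corrMatrix (γ : ℝ) (p n : ℕ) : Matrix (Fin n) (Fin n) ℝ :=
  Matrix.of fun i j =>
    if j ≤ i ∧ (i : ℕ) - (j : ℕ) < p then cTilde γ ((i : ℕ) - (j : ℕ)) else 0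

/-- The strategy matrix, defined through its inverse `corrMatrix γ p n`
(which is unitriangular for `p ≥ 1`, see `det_corrMatrix`). -/
def strategyC (γ : ℝ) (p n : ℕ) : Matrix (Fin n) (Fin n) ℝ := (corrMatrix γ p n)⁻¹

/-- The other factor `B = E C⁻¹`, where `E` is the prefix-sum matrix. -/
def factorB (γ : ℝ) (p n : ℕ) : Matrix (Fin n) (Fin n) ℝ :=
  prefixSum n * (strategyC γ p n)⁻¹

/-- A participation pattern: a set of at most `k` steps, any two of which are at least
`b` apart. -/
def IsParticipation {n : ℕ} (k b : ℕ) (S : Finset (Fin n)) : Prop :=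
  S.card ≤ k ∧ ∀ i ∈ S, ∀ j ∈ S, i < j → (i : ℕ) + b ≤ (j : ℕ)

/-- Two streams of `n` gradients in `ℝ^d` (the rows of `G` and `G'`) are neighbouring if they
differ only in the steps of one participation pattern, and there by a vector of Euclidean norm
at most `1` (the contribution of one data point, whose gradients are clipped to norm `1`). -/
def Neighbouring {n d : ℕ} (k b : ℕ) (G G' : Matrix (Fin n) (Fin d) ℝ) : Prop :=
  ∃ S : Finset (Fin n), IsParticipation k b S ∧
    (∀ i ∉ S, G i = G' i) ∧ ∀ i ∈ S, ‖WithLp.toLp 2 (G i - G' i)‖ ≤ 1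

/-- The values whose supremum is the sensitivity. -/
def sensSet {n : ℕ} (d k b : ℕ) (C : Matrix (Fin n) (Fin n) ℝ) : Set ℝ :=
  {r | ∃ G G' : Matrix (Fin n) (Fin d) ℝ, Neighbouring k b G G' ∧ r = ‖C * G - C * G'‖}

/-- The sensitivity of `C` under `b`-min-separation with at most `k` participations:
`sup ‖C G - C G'‖_F` over neighbouring streams of `d`-dimensional gradients. The supremum is
over a nonempty bounded set, see `isLUB_sens`. -/
def sens {n : ℕ} (d k b : ℕ) (C : Matrix (Fin n) (Fin n) ℝ) : ℝ := sSup (sensSet d k b C)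

/-- The root mean squared error objective `‖B‖_F * sens_{k,b}(C) / √n`. -/
def rmse {n : ℕ} (d k b : ℕ) (B C : Matrix (Fin n) (Fin n) ℝ) : ℝ :=
  ‖B‖ * sens d k b C / √(n : ℝ)

theorem det_corrMatrix (γ : ℝ) {p : ℕ} (hp : 1 ≤ p) (n : ℕ) : (corrMatrix γ p n).det = 1 := by
  rw [Matrix.det_of_isLowerTriangular]
  · apply Finset.prod_eq_one
    intro i _
    have : 0 < p := hp
    simp [corrMatrix, cTilde, genBinom, this]
  · intro i j hij
    have h : i < j := by simpa using hij
    simp [corrMatrix, not_le.mpr h]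

theorem factorB_mul_strategyC (γ : ℝ) {p : ℕ} (hp : 1 ≤ p) (n : ℕ) :
    factorB γ p n * strategyC γ p n = prefixSum n := by
  have h : IsUnit (corrMatrix γ p n).det := by rw [det_corrMatrix γ hp]; exact isUnit_one
  have h' : IsUnit (strategyC γ p n).det := by
    unfold strategyC; exact Matrix.isUnit_nonsing_inv_det _ h
  rw [factorB, Matrix.mul_assoc, Matrix.nonsing_inv_mul _ h', Matrix.mul_one]

theorem isLUB_sens {n : ℕ} (d k b : ℕ) (C : Matrix (Fin n) (Fin n) ℝ) :
    IsLUB (sensSet d k b C) (sens d k b C) := by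
  apply isLUB_csSup
  · exact ⟨_, 0, 0, ⟨∅, by simp [IsParticipation], by simp, by simp⟩, rfl⟩
  · refine ⟨‖C‖ * √(n : ℝ), ?_⟩
    rintro r ⟨G, G', ⟨S, -, h0, h1⟩, rfl⟩
    rw [← Matrix.mul_sub]
    refine (Matrix.frobenius_norm_mul C (G - G')).trans ?_
    refine mul_le_mul_of_nonneg_left ?_ (norm_nonneg _)
    rw [Matrix.frobenius_norm_def, ← Real.sqrt_eq_rpow]
    apply Real.sqrt_le_sqrt
    have hrow : ∀ i, ∑ j, ‖(G - G') i j‖ ^ (2 : ℝ) ≤ 1 := by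
      intro i
      by_cases hi : i ∈ S
      · have h := h1 i hi
        rw [EuclideanSpace.norm_eq, Real.sqrt_le_one] at h
        simpa using h
      · have h := h0 i hi
        simp [h]
    calc _ ≤ ∑ _i : Fin n, (1 : ℝ) := Finset.sum_le_sum fun i _ => hrow i
      _ = n := by simp

end

end BIFR

/-! Lower triangular Toeplitz matrices multiply like power series. With T the first `p` terms of (1
- x)^γ, the strategy C has symbol 1/T, with coefficients a_m (`recipCoeff`), and B has symbol T/(1 -
x), with coefficients s_m = b_min(m, p-1) (`sumCoeff`), where b_m are those of (1 - x)^(γ-1). The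
identity C B = E reads ∑ a_i s_(m-i) = 1.

The sequence s is positive and log-convex, so by Kaluza's theorem its reciprocal series (1 - x)/T
has nonpositive coefficients after the first: a is antitone. It is also nonnegative. The identity
then gives ∑ a_m ≤ 1/b_(p-1) and a_m ≤ (m+1)^(γ-1).

For antitone nonnegative a, columns of C at least `b` apart overlap little, so sens² ≤ 2k(∑ a_m² +
(∑ a_m)²/b) (`sens_sq_le`), while ‖B‖² ≤ n(∑_(m<p) b_m² + n b_(p-1)²). The product of the two square
roots has four terms, one for each term of the claim (`rmse_le`). Power bounds on a_m and b_m
finish, the three cases being the convergence or divergence of ∑ a_m² and ∑ b_m². -/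

namespace BIFR

open Finset

/-! ### Toeplitz matrices and the symbols of the two factors -/

/-- The lower triangular Toeplitz matrix of the coefficients of a power series. -/
noncomputable def toeplitz (n : ℕ) (F : PowerSeries ℝ) : Matrix (Fin n) (Fin n) ℝ :=
  Matrix.of fun i j => if j ≤ i then PowerSeries.coeff ((i : ℕ) - (j : ℕ)) F else 0

theorem toeplitz_mul (n : ℕ) (F G : PowerSeries ℝ) :
    toeplitz n F * toeplitz n G = toeplitz n (F * G) := by
  ext i j
  have h : (toeplitz n F * toeplitz n G) i j
      = ∑ k ∈ range n, (if k ≤ (i : ℕ) then PowerSeries.coeff ((i : ℕ) - k) F else 0) *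
          (if (j : ℕ) ≤ k then PowerSeries.coeff (k - (j : ℕ)) G else 0) := by
    rw [Finset.sum_range, Matrix.mul_apply]
    rfl
  rw [h]
  simp only [toeplitz, Matrix.of_apply, Fin.le_def]
  split_ifs with hij
  · rw [PowerSeries.coeff_mul]
    symm
    -- Only the middle indices between `j` and `i` contribute; they correspond to the antidiagonal
    -- of `i - j`.
    rw [← Finset.sum_subset (s₁ := Icc (j : ℕ) i)]
    · refine Finset.sum_nbij' (fun x => (j : ℕ) + x.2) (fun k => ((i : ℕ) - k, k - j)) ?_ ?_ ?_ ?_ ?_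
      · intro x hx; simp only [HasAntidiagonal.mem_antidiagonal] at hx; simp only [mem_Icc]; omega
      · intro k hk; simp only [mem_Icc] at hk; simp only [HasAntidiagonal.mem_antidiagonal]; omega
      · intro x hx; simp only [HasAntidiagonal.mem_antidiagonal] at hx; ext <;> simp; omega
      · intro k hk; simp only [mem_Icc] at hk; simp only; omega
      · intro x hx
        simp only [HasAntidiagonal.mem_antidiagonal] at hx
        have h1 : (j : ℕ) + x.2 ≤ i := by omega
        have h2 : (i : ℕ) - (j + x.2) = x.1 := by omega
        simp [h1, h2]
    · intro k hk; simp only [mem_Icc] at hk; simp only [mem_range]; omega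
    · intro k _ hk
      simp only [mem_Icc, not_and_or, not_le] at hk
      rcases hk with hk | hk
      · simp [not_le.mpr hk]
      · simp [not_le.mpr hk]
  · refine Finset.sum_eq_zero fun k _ => ?_
    by_cases hk : (j : ℕ) ≤ k
    · have : ¬ k ≤ (i : ℕ) := by omega
      simp [this]
    · simp [hk]

theorem toeplitz_one (n : ℕ) : toeplitz n 1 = 1 := by
  ext i j
  simp only [toeplitz, Matrix.of_apply, PowerSeries.coeff_one, Matrix.one_apply, Fin.le_def,
    Fin.ext_iff]
  split_ifs <;> first | rfl | omega

/-- The first `p` terms of the power series of `(1 - x)^γ`. -/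
noncomputable def truncSeries (γ : ℝ) (p : ℕ) : PowerSeries ℝ :=
  PowerSeries.mk fun i => if i < p then cTilde γ i else 0

/-- The coefficients of the reciprocal of `truncSeries γ p`. -/
noncomputable def recipCoeff (γ : ℝ) (p m : ℕ) : ℝ :=
  PowerSeries.coeff m (truncSeries γ p)⁻¹

/-- The coefficients of `(1 - x)^(γ - 1)`. -/
noncomputable def bCoeff (γ : ℝ) (m : ℕ) : ℝ := ∏ j ∈ range m, (1 - γ / ((j : ℝ) + 1))

theorem bCoeff_succ (γ : ℝ) (m : ℕ) :
    bCoeff γ (m + 1) = bCoeff γ m * (1 - γ / ((m : ℝ) + 1)) := by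
  simp [bCoeff, Finset.prod_range_succ]

theorem cTilde_zero (γ : ℝ) : cTilde γ 0 = 1 := by simp [cTilde, genBinom]

theorem cTilde_succ (γ : ℝ) (m : ℕ) :
    cTilde γ (m + 1) = -(γ / ((m : ℝ) + 1)) * bCoeff γ m := by
  induction m with
  | zero => simp [cTilde, genBinom, bCoeff]
  | succ m ih =>
    have h : cTilde γ (m + 1 + 1)
        = cTilde γ (m + 1) * (-((γ + 1 - ((m : ℝ) + 2)) / ((m : ℝ) + 2))) := by
      simp only [cTilde, genBinom]
      rw [Finset.prod_Icc_succ_top (b := m + 1) (by omega), pow_succ _ (m + 1)]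
      push_cast
      ring
    rw [h, ih, bCoeff_succ]
    push_cast
    have h1 : (m : ℝ) + 1 ≠ 0 := by positivity
    have h2 : (m : ℝ) + 2 ≠ 0 := by positivity
    have h3 : (m : ℝ) + 1 + 1 ≠ 0 := by positivity
    field_simp
    ring

theorem sum_cTilde (γ : ℝ) (m : ℕ) : ∑ i ∈ range (m + 1), cTilde γ i = bCoeff γ m := by
  induction m with
  | zero => simp [cTilde_zero, bCoeff]
  | succ m ih => rw [Finset.sum_range_succ, ih, cTilde_succ, bCoeff_succ]; ring

/-- The coefficients of `truncSeries γ p / (1 - x)`. -/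
noncomputable def sumCoeff (γ : ℝ) (p m : ℕ) : ℝ := bCoeff γ (min m (p - 1))

theorem coeff_mk_one_mul (F : PowerSeries ℝ) (m : ℕ) :
    PowerSeries.coeff m (PowerSeries.mk 1 * F) = ∑ i ∈ range (m + 1), PowerSeries.coeff i F := by
  rw [PowerSeries.coeff_mul, Finset.Nat.sum_antidiagonal_eq_sum_range_succ_mk,
    ← Finset.sum_range_reflect]
  refine Finset.sum_congr rfl fun i hi => ?_
  have : i < m + 1 := Finset.mem_range.mp hi
  have h : m - (m - i) = i := by omega
  simp [h]

theorem coeff_mk_one_mul_truncSeries (γ : ℝ) {p : ℕ} (hp : 1 ≤ p) (m : ℕ) :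
    PowerSeries.coeff m (PowerSeries.mk 1 * truncSeries γ p) = sumCoeff γ p m := by
  rw [coeff_mk_one_mul, sumCoeff, ← sum_cTilde]
  simp only [truncSeries, PowerSeries.coeff_mk]
  rw [← Finset.sum_filter]
  refine Finset.sum_congr ?_ fun _ _ => rfl
  ext i
  simp only [mem_filter, mem_range]
  omega

theorem truncSeries_mul_inv (γ : ℝ) {p : ℕ} (hp : 1 ≤ p) :
    truncSeries γ p * (truncSeries γ p)⁻¹ = 1 := by
  apply PowerSeries.mul_inv_cancel
  have : 0 < p := hp
  rw [← PowerSeries.coeff_zero_eq_constantCoeff_apply]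
  simp [truncSeries, this, cTilde_zero]

theorem corrMatrix_eq_toeplitz (γ : ℝ) (p n : ℕ) :
    corrMatrix γ p n = toeplitz n (truncSeries γ p) := by
  ext i j
  simp only [corrMatrix, toeplitz, truncSeries, Matrix.of_apply, PowerSeries.coeff_mk]
  split_ifs <;> first | rfl | tauto

theorem strategyC_eq_toeplitz (γ : ℝ) {p : ℕ} (hp : 1 ≤ p) (n : ℕ) :
    strategyC γ p n = toeplitz n (truncSeries γ p)⁻¹ := by
  rw [strategyC]
  apply Matrix.inv_eq_right_inv
  rw [corrMatrix_eq_toeplitz, toeplitz_mul, truncSeries_mul_inv γ hp, toeplitz_one]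

theorem factorB_eq_toeplitz (γ : ℝ) {p : ℕ} (hp : 1 ≤ p) (n : ℕ) :
    factorB γ p n = toeplitz n (PowerSeries.mk 1 * truncSeries γ p) := by
  have h : IsUnit (corrMatrix γ p n).det := by rw [det_corrMatrix γ hp]; exact isUnit_one
  rw [factorB, strategyC, Matrix.nonsing_inv_nonsing_inv _ h, corrMatrix_eq_toeplitz,
    ← toeplitz_mul]
  congr 1

theorem strategyC_apply (γ : ℝ) {p : ℕ} (hp : 1 ≤ p) {n : ℕ} (i j : Fin n) :
    strategyC γ p n i j = if j ≤ i then recipCoeff γ p ((i : ℕ) - j) else 0 := by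
  rw [strategyC_eq_toeplitz γ hp]; rfl

theorem factorB_apply (γ : ℝ) {p : ℕ} (hp : 1 ≤ p) {n : ℕ} (i j : Fin n) :
    factorB γ p n i j = if j ≤ i then sumCoeff γ p ((i : ℕ) - j) else 0 := by
  rw [factorB_eq_toeplitz γ hp]
  simp only [toeplitz, Matrix.of_apply, coeff_mk_one_mul_truncSeries γ hp]

/-! ### Signs, monotonicity and Kaluza's theorem -/

theorem bCoeff_pos {γ : ℝ} (h1 : γ < 1) (m : ℕ) : 0 < bCoeff γ m := by
  refine Finset.prod_pos fun j _ => ?_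
  have : (0 : ℝ) < (j : ℝ) + 1 := by positivity
  rw [sub_pos, div_lt_one this]
  have : (0 : ℝ) ≤ j := Nat.cast_nonneg j
  linarith

theorem bCoeff_antitone {γ : ℝ} (h0 : 0 < γ) (h1 : γ < 1) : Antitone (bCoeff γ) := by
  refine antitone_nat_of_succ_le fun m => ?_
  rw [bCoeff_succ]
  refine mul_le_of_le_one_right (bCoeff_pos h1 m).le ?_
  have : 0 ≤ γ / ((m : ℝ) + 1) := by positivity
  linarith

theorem sumCoeff_pos {γ : ℝ} (h1 : γ < 1) (p m : ℕ) : 0 < sumCoeff γ p m := bCoeff_pos h1 _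

theorem bCoeff_le_sumCoeff {γ : ℝ} (h0 : 0 < γ) (h1 : γ < 1) (p m : ℕ) :
    bCoeff γ m ≤ sumCoeff γ p m := bCoeff_antitone h0 h1 (min_le_left _ _)

theorem bCoeff_pred_le_sumCoeff {γ : ℝ} (h0 : 0 < γ) (h1 : γ < 1) (p m : ℕ) :
    bCoeff γ (p - 1) ≤ sumCoeff γ p m := bCoeff_antitone h0 h1 (min_le_right _ _)

/-- The ratios of consecutive terms of `sumCoeff` are nondecreasing. -/
theorem sumCoeff_logConvex {γ : ℝ} (h0 : 0 < γ) (h1 : γ < 1) (p : ℕ) {j m : ℕ} (hjm : j ≤ m) :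
    sumCoeff γ p (j + 1) * sumCoeff γ p m ≤ sumCoeff γ p j * sumCoeff γ p (m + 1) := by
  have key : ∀ i, ∃ ρ : ℝ, sumCoeff γ p (i + 1) = sumCoeff γ p i * ρ ∧
      ρ = if i + 1 ≤ p - 1 then 1 - γ / ((i : ℝ) + 1) else 1 := by
    intro i
    refine ⟨_, ?_, rfl⟩
    simp only [sumCoeff]
    split_ifs with h
    · rw [min_eq_left h, min_eq_left (by omega), bCoeff_succ]
    · rw [min_eq_right (by omega), min_eq_right (by omega), mul_one]
  obtain ⟨r, hr, hr'⟩ := key j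
  obtain ⟨t, ht, ht'⟩ := key m
  have hrt : r ≤ t := by
    have hj : 0 ≤ γ / ((j : ℝ) + 1) := by positivity
    rw [hr', ht']
    split_ifs
    · have : (j : ℝ) ≤ m := by exact_mod_cast hjm
      gcongr
    · linarith
    · omega
    · rfl
  rw [hr, ht]
  have := mul_le_mul_of_nonneg_left hrt
    (mul_pos (sumCoeff_pos h1 p j) (sumCoeff_pos h1 p m)).le
  linarith

/-- **Kaluza's theorem**: the reciprocal of a power series with positive log-convex coefficients
has nonpositive coefficients, except for the constant one. -/
theorem kaluza {s d : ℕ → ℝ} (hs : ∀ m, 0 < s m)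
    (hlc : ∀ j m, j ≤ m → s (j + 1) * s m ≤ s j * s (m + 1)) (hd0 : 0 ≤ d 0)
    (hsd : ∀ m, ∑ i ∈ range (m + 2), d i * s (m + 1 - i) = 0) (m : ℕ) : d (m + 1) ≤ 0 := by
  induction m using Nat.strong_induction_on with
  | _ m ih =>
    rcases m with _ | m
    · have h := hsd 0
      simp only [Finset.sum_range_succ, Finset.range_zero, Finset.sum_empty] at h
      norm_num at h
      have h1 := mul_nonneg hd0 (hs 1).le
      by_contra hc
      have h2 := mul_pos (not_le.mp hc) (hs 0)
      norm_num at h2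
      linarith
    · have e1 := hsd (m + 1)
      have e2 := hsd m
      rw [Finset.sum_range_succ, Finset.sum_range_succ'] at e1
      rw [Finset.sum_range_succ'] at e2
      simp only [Nat.sub_zero, Nat.add_sub_add_right, Nat.sub_self] at e1 e2
      -- The relation of order m + 2 times s (m + 1), minus that of order m + 1 times s (m + 2),
      -- eliminates d 0; log-convexity and the induction hypothesis give the sign of what remains.
      have hle : (∑ i ∈ range (m + 1), d (i + 1) * s (m - i)) * s (m + 2)
          ≤ (∑ i ∈ range (m + 1), d (i + 1) * s (m + 1 - i)) * s (m + 1) := by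
        rw [Finset.sum_mul, Finset.sum_mul]
        refine Finset.sum_le_sum fun i hi => ?_
        have hi' : i < m + 1 := Finset.mem_range.mp hi
        have h1 := hlc (m - i) (m + 1) (by omega)
        have h2 : m - i + 1 = m + 1 - i := by omega
        rw [h2] at h1
        have h3 := mul_le_mul_of_nonpos_left h1 (ih i hi')
        linarith
      have e3 : d (m + 1 + 1) * s 0 * s (m + 1) ≤ 0 := by
        have e1' := congrArg (· * s (m + 1)) e1
        have e2' := congrArg (· * s (m + 2)) e2
        simp only [zero_mul] at e1' e2'
        have e4 : m + 1 + 1 = m + 2 := rfl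
        rw [e4] at e1' ⊢
        nlinarith [e1', e2', hle]
      by_contra hc
      have := mul_pos (mul_pos (not_le.mp hc) (hs 0)) (hs (m + 1))
      linarith

theorem recipCoeff_zero (γ : ℝ) {p : ℕ} (hp : 1 ≤ p) : recipCoeff γ p 0 = 1 := by
  have : 0 < p := hp
  simp [truncSeries, this, cTilde_zero, recipCoeff]

/-- This is (1/T) · T/(1 - x) = 1/(1 - x), the source of all size bounds on `recipCoeff`. -/
theorem sum_recipCoeff_mul_sumCoeff (γ : ℝ) {p : ℕ} (hp : 1 ≤ p) (m : ℕ) :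
    ∑ i ∈ range (m + 1), recipCoeff γ p i * sumCoeff γ p (m - i) = 1 := by
  have h : (truncSeries γ p)⁻¹ * (PowerSeries.mk 1 * truncSeries γ p) = PowerSeries.mk 1 := by
    rw [mul_left_comm, mul_comm _ (truncSeries γ p), truncSeries_mul_inv γ hp, mul_one]
  have h' := congrArg (PowerSeries.coeff m) h
  rw [PowerSeries.coeff_mul, Finset.Nat.sum_antidiagonal_eq_sum_range_succ_mk] at h'
  simp only [coeff_mk_one_mul_truncSeries γ hp, PowerSeries.coeff_mk, Pi.one_apply] at h'
  exact h'

/-- The successive differences `d` are the coefficients of (1 - x)/T, the reciprocal of the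
log-convex series T/(1 - x), so Kaluza's theorem applies. -/
theorem recipCoeff_antitone {γ : ℝ} (h0 : 0 < γ) (h1 : γ < 1) {p : ℕ} (hp : 1 ≤ p) :
    Antitone (recipCoeff γ p) := by
  refine antitone_nat_of_succ_le fun m => ?_
  let d : ℕ → ℝ := fun i => match i with
    | 0 => recipCoeff γ p 0
    | i + 1 => recipCoeff γ p (i + 1) - recipCoeff γ p i
  have h := kaluza (s := sumCoeff γ p) (d := d) (sumCoeff_pos h1 p)
    (fun j m hjm => sumCoeff_logConvex h0 h1 p hjm)
    (by change 0 ≤ recipCoeff γ p 0; rw [recipCoeff_zero γ hp]; exact zero_le_one)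
    (by
      intro m
      rw [Finset.sum_range_succ']
      simp only [d, sub_mul, Finset.sum_sub_distrib, Nat.add_sub_add_right]
      rw [sum_recipCoeff_mul_sumCoeff γ hp m]
      have := sum_recipCoeff_mul_sumCoeff γ hp (m + 1)
      rw [Finset.sum_range_succ'] at this
      simp only [Nat.add_sub_add_right] at this
      linarith) m
  have h' : recipCoeff γ p (m + 1) - recipCoeff γ p m ≤ 0 := h
  linarith

/-- All coefficients of T after the first are nonpositive, so the recursion for 1/T preserves
nonnegativity. -/
theorem recipCoeff_nonneg {γ : ℝ} (h0 : 0 < γ) (h1 : γ < 1) {p : ℕ} (hp : 1 ≤ p) (m : ℕ) :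
    0 ≤ recipCoeff γ p m := by
  induction m using Nat.strong_induction_on with
  | _ m ih =>
    rcases m with _ | m
    · rw [recipCoeff_zero γ hp]; exact zero_le_one
    · have h := congrArg (PowerSeries.coeff (m + 1)) (truncSeries_mul_inv γ hp)
      rw [PowerSeries.coeff_mul, Finset.Nat.sum_antidiagonal_eq_sum_range_succ_mk,
        Finset.sum_range_succ'] at h
      have hp' : 0 < p := hp
      simp only [truncSeries, PowerSeries.coeff_mk, hp', if_true, cTilde_zero, one_mul,
        PowerSeries.coeff_one, Nat.sub_zero, Nat.add_sub_add_right] at h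
      have hle : ∑ i ∈ range (m + 1), (if i + 1 < p then cTilde γ (i + 1) else 0) *
          PowerSeries.coeff (m - i) (truncSeries γ p)⁻¹ ≤ 0 := by
        refine Finset.sum_nonpos fun i _ => mul_nonpos_of_nonpos_of_nonneg ?_ (ih _ (by omega))
        split_ifs
        · rw [cTilde_succ, neg_mul, neg_nonpos]
          have := bCoeff_pos h1 i
          positivity
        · rfl
      simp only [truncSeries, Nat.succ_ne_zero, if_false] at h hle
      rw [recipCoeff, truncSeries]
      linarith

theorem sum_recipCoeff_le {γ : ℝ} (h0 : 0 < γ) (h1 : γ < 1) {p : ℕ} (hp : 1 ≤ p) (n : ℕ) :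
    ∑ m ∈ range n, recipCoeff γ p m ≤ 1 / bCoeff γ (p - 1) := by
  rw [le_div_iff₀ (bCoeff_pos h1 _)]
  rcases n with _ | n
  · simp
  rw [← sum_recipCoeff_mul_sumCoeff γ hp n, Finset.sum_mul]
  exact Finset.sum_le_sum fun i _ => mul_le_mul_of_nonneg_left
    (bCoeff_pred_le_sumCoeff h0 h1 p _) (recipCoeff_nonneg h0 h1 hp i)

/-- In the convolution identity, each `recipCoeff γ p i` with `i ≤ m` is at least the last one, and
`sumCoeff` dominates `bCoeff`. -/
theorem recipCoeff_mul_sum_bCoeff_le {γ : ℝ} (h0 : 0 < γ) (h1 : γ < 1) {p : ℕ} (hp : 1 ≤ p)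
    (m : ℕ) : recipCoeff γ p m * ∑ i ∈ range (m + 1), bCoeff γ i ≤ 1 := by
  rw [← sum_recipCoeff_mul_sumCoeff γ hp m, Finset.mul_sum, ← Finset.sum_range_reflect]
  refine Finset.sum_le_sum fun i hi => ?_
  have hi' : i < m + 1 := Finset.mem_range.mp hi
  have h : m + 1 - 1 - i = m - i := by omega
  rw [h]
  exact mul_le_mul (recipCoeff_antitone h0 h1 hp (by omega)) (bCoeff_le_sumCoeff h0 h1 p _)
    (bCoeff_pos h1 _).le (recipCoeff_nonneg h0 h1 hp i)

/-! ### Frobenius norm and sensitivity of Toeplitz matrices -/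

theorem frobenius_norm_sq {m n : Type*} [Fintype m] [Fintype n] (M : Matrix m n ℝ) :
    ‖M‖ ^ 2 = ∑ i, ∑ j, M i j ^ 2 := by
  rw [Matrix.frobenius_norm_def, ← Real.sqrt_eq_rpow, Real.sq_sqrt (by positivity)]
  simp

theorem sum_comp_le_sum_range {ι : Type*} {f : ℕ → ℝ} (hf : ∀ m, 0 ≤ f m) {n : ℕ}
    (t : Finset ι) (g : ι → ℕ) (hg : Set.InjOn g t) (hn : ∀ x ∈ t, g x < n) :
    ∑ x ∈ t, f (g x) ≤ ∑ m ∈ range n, f m := by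
  classical
  rw [← Finset.sum_image (g := g) (f := f) hg]
  refine Finset.sum_le_sum_of_subset_of_nonneg ?_ fun m _ _ => hf m
  intro m hm
  obtain ⟨x, hx, rfl⟩ := Finset.mem_image.mp hm
  exact Finset.mem_range.mpr (hn x hx)

theorem sum_row_le {f : ℕ → ℝ} (hf : ∀ m, 0 ≤ f m) {n : ℕ} (i : Fin n) :
    ∑ j : Fin n, (if j ≤ i then f ((i : ℕ) - j) else 0) ≤ ∑ m ∈ range n, f m := by
  rw [← Finset.sum_filter]
  refine sum_comp_le_sum_range hf _ (fun j : Fin n => (i : ℕ) - j) ?_ ?_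
  · intro x hx y hy hxy
    simp only [coe_filter, mem_univ, true_and, Set.mem_ofPred_eq, Fin.le_def] at hx hy hxy
    ext; omega
  · intro x _; have := i.2; omega

theorem sum_col_le {f : ℕ → ℝ} (hf : ∀ m, 0 ≤ f m) {n : ℕ} (j : Fin n) :
    ∑ i : Fin n, (if j ≤ i then f ((i : ℕ) - j) else 0) ≤ ∑ m ∈ range n, f m := by
  rw [← Finset.sum_filter]
  refine sum_comp_le_sum_range hf _ (fun i : Fin n => (i : ℕ) - j) ?_ ?_
  · intro x hx y hy hxy
    simp only [coe_filter, mem_univ, true_and, Set.mem_ofPred_eq, Fin.le_def] at hx hy hxy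
    ext; omega
  · intro x _; have := x.2; omega

/-- By symmetry, the pairs `l ≤ j` counted twice cover the whole square, the diagonal being counted
once too often. -/
theorem sq_sum_le_two_mul {ι : Type*} [LinearOrder ι] (S : Finset ι) {x : ι → ℝ}
    (hx : ∀ j, 0 ≤ x j) :
    (∑ j ∈ S, x j) ^ 2 ≤ 2 * ∑ j ∈ S, x j * (x j + ∑ l ∈ S with l < j, x l) := by
  have h1 : ∑ j ∈ S, x j * (x j + ∑ l ∈ S with l < j, x l)
      = ∑ j ∈ S, ∑ l ∈ S, if l ≤ j then x j * x l else 0 := by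
    refine Finset.sum_congr rfl fun j hj => ?_
    rw [← Finset.sum_filter, ← Finset.mul_sum]
    congr 1
    have : S.filter (· ≤ j) = insert j (S.filter (· < j)) := by
      ext l
      simp only [mem_filter, mem_insert, le_iff_lt_or_eq]
      constructor
      · rintro ⟨h, h' | h'⟩
        · exact Or.inr ⟨h, h'⟩
        · exact Or.inl h'
      · rintro (rfl | ⟨h, h'⟩)
        · exact ⟨hj, Or.inr rfl⟩
        · exact ⟨h, Or.inl h'⟩
    rw [this, Finset.sum_insert (by simp)]
  have h2 : ∑ j ∈ S, ∑ l ∈ S, (if l ≤ j then x j * x l else 0)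
      = ∑ j ∈ S, ∑ l ∈ S, (if j ≤ l then x j * x l else 0) := by
    rw [Finset.sum_comm]
    refine Finset.sum_congr rfl fun j _ => Finset.sum_congr rfl fun l _ => ?_
    rw [mul_comm]
  rw [two_mul, h1]
  nth_rewrite 2 [h2]
  rw [← Finset.sum_add_distrib, sq, Finset.sum_mul_sum]
  refine Finset.sum_le_sum fun j _ => ?_
  rw [← Finset.sum_add_distrib]
  refine Finset.sum_le_sum fun l _ => ?_
  have := mul_nonneg (hx j) (hx l)
  rcases le_total l j with h | h
  · rw [if_pos h]; split_ifs <;> linarith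
  · rw [if_pos h]; split_ifs <;> linarith

/-- Summing an antitone sequence along points at least `b` apart costs a factor `1 / b`. -/
theorem mul_sum_separated_le {a : ℕ → ℝ} (ha : Antitone a) (ha0 : ∀ m, 0 ≤ a m) {n k b : ℕ}
    {S : Finset (Fin n)} (hS : IsParticipation k b S) {i j : Fin n} (hj : j ∈ S)
    (hji : j ≤ i) :
    (b : ℝ) * ∑ l ∈ S with l < j, a ((i : ℕ) - l) ≤ ∑ m ∈ range n, a m := by
  -- Each term is bounded by `a` at the `b` indices i - l - t, t < b. Separation makes these blocks
  -- disjoint, and i - l ≥ j - l ≥ b keeps the natural subtraction from truncating.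
  have h1 : (b : ℝ) * ∑ l ∈ S with l < j, a ((i : ℕ) - l)
      ≤ ∑ x ∈ (S.filter (· < j)) ×ˢ range b, a ((i : ℕ) - x.1 - x.2) := by
    rw [Finset.sum_product, Finset.mul_sum]
    refine Finset.sum_le_sum fun l _ => ?_
    rw [← nsmul_eq_mul, ← Finset.card_range b, ← Finset.sum_const, Finset.card_range]
    exact Finset.sum_le_sum fun t _ => ha (Nat.sub_le _ _)
  refine h1.trans (sum_comp_le_sum_range ha0 _
    (fun x : Fin n × ℕ => (i : ℕ) - x.1 - x.2) ?_ ?_)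
  · rintro ⟨x, t⟩ hx ⟨y, u⟩ hy hxy
    simp only [coe_product, Set.mem_prod, mem_coe, mem_filter, mem_range] at hx hy
    simp only at hxy
    obtain ⟨⟨hxS, hxj⟩, ht⟩ := hx
    obtain ⟨⟨hyS, hyj⟩, hu⟩ := hy
    have e1 := hS.2 x hxS j hj hxj
    have e2 := hS.2 y hyS j hj hyj
    have e3 : (j : ℕ) ≤ i := hji
    rcases lt_trichotomy x y with h | h | h
    · have := hS.2 x hxS y hyS h
      omega
    · subst h
      ext
      · rfl
      · simp only; omega
    · have := hS.2 y hyS x hxS h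
      omega
  · intro x _; have := i.2; omega

/-- A sensitivity bound for lower triangular Toeplitz matrices with nonnegative, antitone
coefficients. -/
theorem sens_sq_le {a : ℕ → ℝ} (ha : Antitone a) (ha0 : ∀ m, 0 ≤ a m) {n k b : ℕ} (hb : 1 ≤ b)
    (d : ℕ) {C : Matrix (Fin n) (Fin n) ℝ}
    (hC : ∀ i j, C i j = if j ≤ i then a ((i : ℕ) - j) else 0) {A2 L : ℝ}
    (hA : ∑ m ∈ range n, a m ^ 2 ≤ A2) (hL : ∑ m ∈ range n, a m ≤ L) :
    sens d k b C ≤ √(2 * k * (A2 + L ^ 2 / b)) := by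
  have hb' : (0 : ℝ) < b := by exact_mod_cast hb
  have hC0 : ∀ i j, 0 ≤ C i j := by
    intro i j; rw [hC]; split_ifs
    · exact ha0 _
    · rfl
  have hL0 : 0 ≤ L := (Finset.sum_nonneg fun m _ => ha0 m).trans hL
  have hA0 : 0 ≤ A2 := (Finset.sum_nonneg fun m _ => sq_nonneg _).trans hA
  refine (isLUB_le_iff (isLUB_sens d k b C)).mpr ?_
  rintro r ⟨G, G', ⟨S, hS, hG0, hG1⟩, rfl⟩
  apply Real.le_sqrt_of_sq_le
  rw [← Matrix.mul_sub, frobenius_norm_sq]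
  have hrow : ∀ i, ∑ j, (C * (G - G')) i j ^ 2 ≤ (∑ j ∈ S, C i j) ^ 2 := by
    intro i
    have e1 : ∑ j, (C * (G - G')) i j ^ 2 = ‖WithLp.toLp 2 ((C * (G - G')) i)‖ ^ 2 := by
      rw [EuclideanSpace.norm_sq_eq]; simp
    have e2 : WithLp.toLp 2 ((C * (G - G')) i)
        = ∑ j ∈ S, C i j • WithLp.toLp 2 (G j - G' j) := by
      ext t
      simp only [Matrix.mul_apply, WithLp.ofLp_sum, WithLp.ofLp_smul, Finset.sum_apply,
        Pi.smul_apply, smul_eq_mul, Matrix.sub_apply, Pi.sub_apply]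
      symm
      refine Finset.sum_subset (Finset.subset_univ S) fun j _ hj => ?_
      rw [hG0 j hj]; ring
    rw [e1, e2]
    refine pow_le_pow_left₀ (norm_nonneg _) ((norm_sum_le _ _).trans ?_) 2
    refine Finset.sum_le_sum fun j hj => ?_
    rw [norm_smul, Real.norm_of_nonneg (hC0 i j)]
    exact mul_le_of_le_one_right (hC0 i j) (hG1 j hj)
  -- In row `i`, the cross terms with `l < j` cost at most L / b by separation; for `j > i` the
  -- entry `C i j` vanishes.
  have hrow2 : ∀ i, (∑ j ∈ S, C i j) ^ 2 ≤ 2 * ∑ j ∈ S, (C i j ^ 2 + C i j * (L / b)) := by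
    intro i
    refine (sq_sum_le_two_mul S (hC0 i)).trans ?_
    refine mul_le_mul_of_nonneg_left (Finset.sum_le_sum fun j hj => ?_) zero_le_two
    rw [mul_add, ← sq]
    refine add_le_add le_rfl ?_
    by_cases hji : j ≤ i
    · refine mul_le_mul_of_nonneg_left ?_ (hC0 i j)
      rw [le_div_iff₀ hb', mul_comm]
      refine le_trans (le_of_eq ?_) ((mul_sum_separated_le ha ha0 hS hj hji).trans hL)
      congr 1
      refine Finset.sum_congr rfl fun l hl => ?_
      rw [hC, if_pos ((Finset.mem_filter.mp hl).2.le.trans hji)]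
    · simp [hC i j, hji]
  calc ∑ i, ∑ j, (C * (G - G')) i j ^ 2
      ≤ ∑ i, 2 * ∑ j ∈ S, (C i j ^ 2 + C i j * (L / b)) :=
        Finset.sum_le_sum fun i _ => (hrow i).trans (hrow2 i)
    -- After exchanging the sums, each column sum contributes a second factor L.
    _ = 2 * ∑ j ∈ S, (∑ i, C i j ^ 2 + (∑ i, C i j) * (L / b)) := by
        rw [← Finset.mul_sum, Finset.sum_comm]
        simp only [Finset.sum_add_distrib, Finset.sum_mul]
    _ ≤ 2 * ∑ _j ∈ S, (A2 + L * (L / b)) := by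
        refine mul_le_mul_of_nonneg_left (Finset.sum_le_sum fun j _ => ?_) zero_le_two
        have h1 : ∑ i, C i j ^ 2 ≤ A2 := by
          refine le_trans (le_of_eq ?_)
            ((sum_col_le (f := fun m => a m ^ 2) (fun m => sq_nonneg _) j).trans hA)
          refine Finset.sum_congr rfl fun i _ => ?_
          rw [hC]; split_ifs <;> simp
        have h2 : ∑ i, C i j ≤ L := by
          simp only [hC]
          exact (sum_col_le ha0 j).trans hL
        have h3 : 0 ≤ L / b := by positivity
        gcongr
    _ ≤ 2 * k * (A2 + L ^ 2 / b) := by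
        rw [Finset.sum_const, nsmul_eq_mul]
        have h1 : (S.card : ℝ) ≤ k := by exact_mod_cast hS.1
        have h2 : L * (L / b) = L ^ 2 / b := by ring
        have h3 : 0 ≤ L ^ 2 / b := by positivity
        rw [h2, mul_assoc]
        gcongr

/-! ### The error as a product of two square roots -/

theorem norm_factorB_sq_le (γ : ℝ) {p : ℕ} (hp : 1 ≤ p) (n : ℕ) :
    ‖factorB γ p n‖ ^ 2
      ≤ n * (∑ m ∈ range p, bCoeff γ m ^ 2 + n * bCoeff γ (p - 1) ^ 2) := by
  have hsum : ∑ m ∈ range n, sumCoeff γ p m ^ 2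
      ≤ ∑ m ∈ range p, bCoeff γ m ^ 2 + n * bCoeff γ (p - 1) ^ 2 := by
    calc ∑ m ∈ range n, sumCoeff γ p m ^ 2
        ≤ ∑ m ∈ range n, ((if m < p then bCoeff γ m ^ 2 else 0) + bCoeff γ (p - 1) ^ 2) := by
          refine Finset.sum_le_sum fun m _ => ?_
          rw [sumCoeff]
          split_ifs with h
          · rw [min_eq_left (by omega)]
            exact le_add_of_nonneg_right (sq_nonneg _)
          · rw [min_eq_right (by omega), zero_add]
      _ ≤ _ := by
          rw [Finset.sum_add_distrib, Finset.sum_const, Finset.card_range, nsmul_eq_mul,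
            ← Finset.sum_filter]
          refine add_le_add (Finset.sum_le_sum_of_subset_of_nonneg ?_ fun m _ _ => sq_nonneg _)
            le_rfl
          intro m hm
          exact Finset.mem_range.mpr (Finset.mem_filter.mp hm).2
  rw [frobenius_norm_sq]
  calc ∑ i, ∑ j, factorB γ p n i j ^ 2
      ≤ ∑ _i : Fin n, (∑ m ∈ range p, bCoeff γ m ^ 2 + n * bCoeff γ (p - 1) ^ 2) := by
        refine Finset.sum_le_sum fun i _ => ?_
        refine le_trans (le_of_eq ?_)
          ((sum_row_le (f := fun m => sumCoeff γ p m ^ 2) (fun m => sq_nonneg _) i).trans hsum)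
        refine Finset.sum_congr rfl fun j _ => ?_
        rw [factorB_apply γ hp]; split_ifs <;> simp
    _ = _ := by rw [Finset.sum_const, Finset.card_univ, Fintype.card_fin, nsmul_eq_mul]

/-- Expanding (√B2 + √n β)(√A2 + 1/(β√b)), the value β = b_(p-1) cancels in one cross product and
leaves √(nk/b). -/
theorem rmse_le {γ : ℝ} (h0 : 0 < γ) (h1 : γ < 1) {p n k b : ℕ} (hp : 1 ≤ p) (hn : 1 ≤ n)
    (hb : 1 ≤ b) (d : ℕ) {A2 B2 : ℝ} (hA : ∑ m ∈ range n, recipCoeff γ p m ^ 2 ≤ A2)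
    (hB : ∑ m ∈ range p, bCoeff γ m ^ 2 ≤ B2) :
    rmse d k b (factorB γ p n) (strategyC γ p n) ≤
      2 * (√k * √(A2 * B2) + √((n : ℝ) * k / b) + √((k : ℝ) / b) * (√B2 / bCoeff γ (p - 1))
        + √((n : ℝ) * k) * (√A2 * bCoeff γ (p - 1))) := by
  have hn' : (0 : ℝ) < n := by exact_mod_cast hn
  have hb' : (0 : ℝ) < b := by exact_mod_cast hb
  have hβ := bCoeff_pos h1 (p - 1)
  set β := bCoeff γ (p - 1) with hβdef
  have hA0 : 0 ≤ A2 := (Finset.sum_nonneg fun m _ => sq_nonneg _).trans hA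
  have hB0 : 0 ≤ B2 := (Finset.sum_nonneg fun m _ => sq_nonneg _).trans hB
  have hs := sens_sq_le (recipCoeff_antitone h0 h1 hp) (recipCoeff_nonneg h0 h1 hp) (k := k) hb d
    (strategyC_apply γ hp (n := n)) hA (sum_recipCoeff_le h0 h1 hp n)
  rw [← hβdef] at hs
  have hsqrt_add : ∀ x y : ℝ, 0 ≤ x → 0 ≤ y → √(x + y) ≤ √x + √y := by
    intro x y hx hy
    rw [Real.sqrt_le_iff]
    refine ⟨by positivity, ?_⟩
    rw [add_sq, Real.sq_sqrt hx, Real.sq_sqrt hy]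
    have : 0 ≤ 2 * √x * √y := by positivity
    linarith
  have hsens : sens d k b (strategyC γ p n) ≤ 2 * √k * (√A2 + 1 / (β * √b)) := by
    refine hs.trans ?_
    rw [Real.sqrt_mul (by positivity), Real.sqrt_mul zero_le_two]
    have e1 : √(2 : ℝ) ≤ 2 := by rw [Real.sqrt_le_iff]; norm_num
    have e2 : √(A2 + (1 / β) ^ 2 / b) ≤ √A2 + 1 / (β * √b) := by
      refine (hsqrt_add _ _ hA0 (by positivity)).trans (le_of_eq ?_)
      rw [Real.sqrt_div (by positivity), Real.sqrt_sq (by positivity), div_div]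
    gcongr
  have hnorm : ‖factorB γ p n‖ ≤ √n * (√B2 + √n * β) := by
    have h2 : ‖factorB γ p n‖ ≤ √(n * (B2 + n * β ^ 2)) := by
      apply Real.le_sqrt_of_sq_le
      refine (norm_factorB_sq_le γ hp n).trans ?_
      gcongr
    refine h2.trans ?_
    rw [Real.sqrt_mul hn'.le]
    refine mul_le_mul_of_nonneg_left ?_ (Real.sqrt_nonneg _)
    refine (hsqrt_add _ _ hB0 (by positivity)).trans (le_of_eq ?_)
    rw [Real.sqrt_mul hn'.le, Real.sqrt_sq hβ.le]
  have hsn : 0 < √(n : ℝ) := Real.sqrt_pos.mpr hn'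
  have hsb : 0 < √(b : ℝ) := Real.sqrt_pos.mpr hb'
  have hsens0 : 0 ≤ sens d k b (strategyC γ p n) := by
    refine Real.sSup_nonneg ?_
    rintro r ⟨G, G', -, rfl⟩
    exact norm_nonneg _
  rw [rmse, div_le_iff₀ hsn]
  calc ‖factorB γ p n‖ * sens d k b (strategyC γ p n)
      ≤ (√n * (√B2 + √n * β)) * (2 * √k * (√A2 + 1 / (β * √b))) := by gcongr
    _ = _ := by
      rw [Real.sqrt_mul hA0, Real.sqrt_div (by positivity), Real.sqrt_div (by positivity),
        Real.sqrt_mul hn'.le]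
      field_simp
      ring

/-! ### Power bounds for the coefficients and their sums -/

theorem one_sub_div_mul_rpow_le {γ x : ℝ} (h0 : 0 < γ) (h1 : γ < 1) (hx : 1 ≤ x) :
    (1 - γ / x) * (x + 1) ^ γ ≤ x ^ γ := by
  have hx0 : 0 < x := by linarith
  have e : x + 1 = x * (1 + 1 / x) := by field_simp
  have hb := rpow_one_add_le_one_add_mul_self (s := 1 / x)
    (le_trans (by norm_num) (by positivity : (0 : ℝ) ≤ 1 / x)) h0.le h1.le
  have hy : γ / x ≤ 1 := by rw [div_le_one hx0]; linarith
  rw [e, Real.mul_rpow hx0.le (by positivity)]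
  have hxp : 0 < x ^ γ := Real.rpow_pos_of_pos hx0 _
  calc (1 - γ / x) * (x ^ γ * (1 + 1 / x) ^ γ)
      ≤ (1 - γ / x) * (x ^ γ * (1 + γ * (1 / x))) := by
        have : 0 ≤ 1 - γ / x := by linarith
        gcongr
    _ = x ^ γ * (1 - (γ / x) ^ 2) := by ring
    _ ≤ x ^ γ := mul_le_of_le_one_right hxp.le (by nlinarith [sq_nonneg (γ / x)])

theorem rpow_sub_one_le {u x : ℝ} (h0 : 0 ≤ u) (h1 : u ≤ 1) (hx : 1 ≤ x) :
    (x - 1) ^ u ≤ x ^ u * (1 - u / x) := by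
  have hx0 : 0 < x := by linarith
  have hx1 : 1 / x ≤ 1 := by rw [div_le_one hx0]; exact hx
  have e : x - 1 = x * (1 + -(1 / x)) := by field_simp; ring
  have hb := rpow_one_add_le_one_add_mul_self (s := -(1 / x)) (by linarith) h0 h1
  rw [e, Real.mul_rpow hx0.le (by linarith)]
  refine mul_le_mul_of_nonneg_left (hb.trans (le_of_eq ?_)) (by positivity)
  ring

theorem bCoeff_one (γ : ℝ) : bCoeff γ 1 = 1 - γ := by simp [bCoeff]

theorem bCoeff_succ_mul_rpow_le {γ : ℝ} (h0 : 0 < γ) (h1 : γ < 1) (m : ℕ) :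
    bCoeff γ (m + 1) * ((m : ℝ) + 2) ^ γ ≤ bCoeff γ m * ((m : ℝ) + 1) ^ γ := by
  have hm : (0 : ℝ) ≤ m := Nat.cast_nonneg m
  have := one_sub_div_mul_rpow_le h0 h1 (x := (m : ℝ) + 1) (by linarith)
  have h2 := mul_le_mul_of_nonneg_left this (bCoeff_pos h1 m).le
  have e : (m : ℝ) + 1 + 1 = m + 2 := by ring
  rw [e] at h2
  rw [bCoeff_succ, mul_assoc]
  exact h2

theorem bCoeff_le {γ : ℝ} (h0 : 0 < γ) (h1 : γ < 1) (m : ℕ) :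
    bCoeff γ m ≤ ((m : ℝ) + 1) ^ (-γ) := by
  have h : bCoeff γ m * ((m : ℝ) + 1) ^ γ ≤ 1 := by
    induction m with
    | zero => simp [bCoeff]
    | succ m ih =>
      refine le_trans (le_of_eq ?_) ((bCoeff_succ_mul_rpow_le h0 h1 m).trans ih)
      push_cast
      congr 2
      ring
  rw [Real.rpow_neg (by positivity), ← one_div, le_div_iff₀ (by positivity)]
  exact h

/-- Starting the monotone quantity b_m (m+1)^γ at m = 1 instead of 0 retains the factor 1 - γ,
needed for the last term as γ → 1. -/
theorem bCoeff_succ_le {γ : ℝ} (h0 : 0 < γ) (h1 : γ < 1) (m : ℕ) :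
    bCoeff γ (m + 1) ≤ 2 * (1 - γ) * ((m : ℝ) + 2) ^ (-γ) := by
  have h : bCoeff γ (m + 1) * ((m : ℝ) + 2) ^ γ ≤ 2 * (1 - γ) := by
    induction m with
    | zero =>
      have h2 : (2 : ℝ) ^ γ ≤ 2 := by
        conv_rhs => rw [← Real.rpow_one 2]
        exact Real.rpow_le_rpow_of_exponent_le (by norm_num) h1.le
      rw [zero_add, bCoeff_one, Nat.cast_zero, zero_add, mul_comm]
      exact mul_le_mul_of_nonneg_right h2 (by linarith)
    | succ m ih =>
      refine le_trans ?_ ((bCoeff_succ_mul_rpow_le h0 h1 (m + 1)).trans (le_trans (le_of_eq ?_) ih))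
      · rfl
      · push_cast
        congr 2
        ring
  rw [Real.rpow_neg (by positivity), ← div_eq_mul_inv, le_div_iff₀ (by positivity)]
  exact h

/-- By Bernoulli's inequality b_m m^γ is nondecreasing from m = 1, where it equals 1 - γ. -/
theorem le_bCoeff_succ {γ : ℝ} (h0 : 0 < γ) (h1 : γ < 1) (m : ℕ) :
    1 - γ ≤ bCoeff γ (m + 1) * ((m : ℝ) + 1) ^ γ := by
  induction m with
  | zero => simp [bCoeff_one]
  | succ m ih =>
    have hm : (0 : ℝ) ≤ m := Nat.cast_nonneg m
    have h := rpow_sub_one_le h0.le h1.le (x := (m : ℝ) + 2) (by linarith)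
    have e : (m : ℝ) + 2 - 1 = m + 1 := by ring
    rw [e] at h
    have h2 := mul_le_mul_of_nonneg_left h (bCoeff_pos h1 (m + 1)).le
    refine ih.trans (h2.trans (le_of_eq ?_))
    rw [bCoeff_succ γ (m + 1)]
    push_cast
    have e2 : (m : ℝ) + 1 + 1 = m + 2 := by ring
    rw [e2]
    ring

theorem one_sub_mul_sum_bCoeff (γ : ℝ) (m : ℕ) :
    (1 - γ) * ∑ i ∈ range (m + 1), bCoeff γ i = ((m : ℝ) + 1) * bCoeff γ (m + 1) := by
  induction m with
  | zero => simp [bCoeff]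
  | succ m ih =>
    rw [Finset.sum_range_succ, mul_add, ih, bCoeff_succ γ (m + 1)]
    push_cast
    have : (m : ℝ) + 1 + 1 ≠ 0 := by positivity
    field_simp
    ring

/-- The factor 1 - γ in the lower bound for b_(m+1) cancels the one in the closed form of ∑ b_i, so
the constant is 1. -/
theorem recipCoeff_le {γ : ℝ} (h0 : 0 < γ) (h1 : γ < 1) {p : ℕ} (hp : 1 ≤ p) (m : ℕ) :
    recipCoeff γ p m ≤ ((m : ℝ) + 1) ^ (γ - 1) := by
  have hx : (0 : ℝ) < (m : ℝ) + 1 := by positivity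
  have h := recipCoeff_mul_sum_bCoeff_le h0 h1 hp m
  have hs : ((m : ℝ) + 1) ^ (1 - γ) ≤ ∑ i ∈ range (m + 1), bCoeff γ i := by
    have e1 := one_sub_mul_sum_bCoeff γ m
    have e2 := mul_le_mul_of_nonneg_left (le_bCoeff_succ h0 h1 m) hx.le
    have hγ : 0 < 1 - γ := by linarith
    refine le_of_mul_le_mul_left ?_ hγ
    rw [e1, Real.rpow_sub hx, Real.rpow_one, ← mul_div_assoc, div_le_iff₀ (by positivity)]
    linarith
  have e : γ - 1 = -(1 - γ) := by ring
  rw [e, Real.rpow_neg hx.le, ← one_div, le_div_iff₀ (by positivity)]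
  exact (mul_le_mul_of_nonneg_left hs (recipCoeff_nonneg h0 h1 hp m)).trans h

theorem bCoeff_pred_le {γ : ℝ} (h0 : 0 < γ) (h1 : γ < 1) {p : ℕ} (hp : 2 ≤ p) :
    bCoeff γ (p - 1) ≤ 2 * (1 - γ) * (p : ℝ) ^ (-γ) := by
  obtain ⟨m, rfl⟩ := Nat.exists_eq_add_of_le' hp
  have := bCoeff_succ_le h0 h1 m
  push_cast
  exact this

theorem inv_bCoeff_pred_le {γ : ℝ} (h0 : 0 < γ) (h1 : γ < 1) {p : ℕ} (hp : 2 ≤ p) :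
    1 / bCoeff γ (p - 1) ≤ (p : ℝ) ^ γ / (1 - γ) := by
  obtain ⟨m, rfl⟩ := Nat.exists_eq_add_of_le' hp
  have hb := bCoeff_pos h1 (m + 1)
  have hm : (0 : ℝ) ≤ m := Nat.cast_nonneg m
  rw [show m + 2 - 1 = m + 1 from rfl, div_le_div_iff₀ hb (by linarith), one_mul, mul_comm]
  refine (le_bCoeff_succ h0 h1 m).trans ?_
  refine mul_le_mul_of_nonneg_left (Real.rpow_le_rpow (by positivity) ?_ h0.le) hb.le
  push_cast
  linarith

theorem sum_rpow_sub_one_le {u : ℝ} (h0 : 0 < u) (h1 : u ≤ 1) (N : ℕ) :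
    ∑ m ∈ range N, ((m : ℝ) + 1) ^ (u - 1) ≤ (N : ℝ) ^ u / u := by
  induction N with
  | zero => simp [Real.zero_rpow h0.ne']
  | succ N ih =>
    have hx : (0 : ℝ) < (N : ℝ) + 1 := by positivity
    have h := rpow_sub_one_le h0.le h1 (x := (N : ℝ) + 1) (by
      have : (0 : ℝ) ≤ N := Nat.cast_nonneg N
      linarith)
    rw [add_sub_cancel_right] at h
    rw [Finset.sum_range_succ, Real.rpow_sub hx, Real.rpow_one]
    push_cast
    refine (add_le_add ih le_rfl).trans ?_
    rw [div_add' _ _ _ h0.ne', div_le_div_iff_of_pos_right h0]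
    have e : ((N : ℝ) + 1) ^ u * (1 - u / ((N : ℝ) + 1))
        = ((N : ℝ) + 1) ^ u - ((N : ℝ) + 1) ^ u / ((N : ℝ) + 1) * u := by ring
    linarith

theorem sum_rpow_neg_le {t : ℝ} (ht : 0 < t) (N : ℕ) :
    ∑ m ∈ range N, ((m : ℝ) + 1) ^ (-(1 + t)) ≤ 1 + 1 / t := by
  -- Keeping the tail term makes the induction telescope; its step follows from log x ≥ 1 - 1/x and
  -- exp y ≥ 1 + y.
  have key : ∀ N : ℕ, ∑ m ∈ range (N + 1), ((m : ℝ) + 1) ^ (-(1 + t))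
      ≤ 1 + 1 / t - ((N : ℝ) + 1) ^ (-t) / t := by
    intro N
    induction N with
    | zero => simp
    | succ N ih =>
      have hN : (0 : ℝ) ≤ N := Nat.cast_nonneg N
      have hy : (0 : ℝ) < (N : ℝ) + 1 := by positivity
      have hx : (0 : ℝ) < (N : ℝ) + 2 := by positivity
      have h1 : ((N : ℝ) + 2) ^ (-t) * (1 + t / ((N : ℝ) + 2)) ≤ ((N : ℝ) + 1) ^ (-t) := by
        have hlog := Real.one_sub_inv_le_log_of_pos (div_pos hx hy)
        have e1 : 1 - (((N : ℝ) + 2) / ((N : ℝ) + 1))⁻¹ = 1 / ((N : ℝ) + 2) := by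
          field_simp; ring
        rw [e1] at hlog
        have e2 : 1 + t / ((N : ℝ) + 2) ≤ (((N : ℝ) + 2) / ((N : ℝ) + 1)) ^ t := by
          rw [Real.rpow_def_of_pos (div_pos hx hy)]
          have h3 := Real.add_one_le_exp (Real.log (((N : ℝ) + 2) / ((N : ℝ) + 1)) * t)
          have h4 := mul_le_mul_of_nonneg_right hlog ht.le
          have e3 : 1 / ((N : ℝ) + 2) * t = t / ((N : ℝ) + 2) := by ring
          linarith
        refine (mul_le_mul_of_nonneg_left e2 (by positivity)).trans (le_of_eq ?_)
        rw [Real.div_rpow hx.le hy.le, Real.rpow_neg hx.le, Real.rpow_neg hy.le]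
        have : ((N : ℝ) + 2) ^ t ≠ 0 := (Real.rpow_pos_of_pos hx t).ne'
        field_simp
      rw [Finset.sum_range_succ]
      push_cast
      have e4 : (N : ℝ) + 1 + 1 = N + 2 := by ring
      have e5 : ((N : ℝ) + 2) ^ (-(1 + t)) = ((N : ℝ) + 2) ^ (-t) / ((N : ℝ) + 2) := by
        rw [show -(1 + t) = -t - 1 by ring, Real.rpow_sub hx, Real.rpow_one]
      rw [e4, e5]
      have h2 : ((N : ℝ) + 2) ^ (-t) / ((N : ℝ) + 2)
          ≤ ((N : ℝ) + 1) ^ (-t) / t - ((N : ℝ) + 2) ^ (-t) / t := by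
        rw [← sub_div, le_div_iff₀ ht]
        have e6 : ((N : ℝ) + 2) ^ (-t) * (1 + t / ((N : ℝ) + 2))
          = ((N : ℝ) + 2) ^ (-t) + ((N : ℝ) + 2) ^ (-t) / ((N : ℝ) + 2) * t := by ring
        linarith
      linarith
  rcases N with _ | N
  · simp only [Finset.range_zero, Finset.sum_empty]; positivity
  · have h : 0 ≤ ((N : ℝ) + 1) ^ (-t) / t := by positivity
    linarith [key N]

theorem sum_inv_le {p : ℕ} (hp : 2 ≤ p) :
    ∑ m ∈ range p, ((m : ℝ) + 1) ^ (-1 : ℝ) ≤ 3 * Real.log p := by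
  have h := harmonic_le_one_add_log p
  have hlog : Real.log 2 ≤ Real.log p := Real.log_le_log (by norm_num) (by exact_mod_cast hp)
  have h2 := Real.log_two_gt_d9
  have e : ((harmonic p : ℚ) : ℝ) = ∑ m ∈ range p, ((m : ℝ) + 1) ^ (-1 : ℝ) := by
    simp [harmonic, Real.rpow_neg_one]
  rw [← e]
  linarith

theorem sq_rpow_add_one (m : ℕ) (y : ℝ) : (((m : ℝ) + 1) ^ y) ^ 2 = ((m : ℝ) + 1) ^ (2 * y) := by
  rw [← Real.rpow_natCast, ← Real.rpow_mul (by positivity), mul_comm]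
  norm_num

theorem sum_bCoeff_sq_le {γ : ℝ} (h0 : 0 < γ) (h1 : γ < 1) (N : ℕ) :
    ∑ m ∈ range N, bCoeff γ m ^ 2 ≤ ∑ m ∈ range N, ((m : ℝ) + 1) ^ (2 * (-γ)) := by
  refine Finset.sum_le_sum fun m _ => ?_
  rw [← sq_rpow_add_one]
  exact pow_le_pow_left₀ (bCoeff_pos h1 m).le (bCoeff_le h0 h1 m) 2

theorem sum_recipCoeff_sq_le {γ : ℝ} (h0 : 0 < γ) (h1 : γ < 1) {p : ℕ} (hp : 1 ≤ p) (N : ℕ) :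
    ∑ m ∈ range N, recipCoeff γ p m ^ 2 ≤ ∑ m ∈ range N, ((m : ℝ) + 1) ^ (2 * (γ - 1)) := by
  refine Finset.sum_le_sum fun m _ => ?_
  rw [← sq_rpow_add_one]
  exact pow_le_pow_left₀ (recipCoeff_nonneg h0 h1 hp m) (recipCoeff_le h0 h1 hp m) 2

/-- For γ ≥ 1/2 the pointwise bound alone would give a sum growing with `n`. From index `p` on, a_m²
≤ a_p a_m, and ∑ a_m ≤ 1/b_(p-1) is independent of `n`. -/
theorem sum_recipCoeff_sq_le_add {γ : ℝ} (h0 : 0 < γ) (h1 : γ < 1) {p : ℕ} (hp : 2 ≤ p)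
    (n : ℕ) : ∑ m ∈ range n, recipCoeff γ p m ^ 2
      ≤ ∑ m ∈ range p, ((m : ℝ) + 1) ^ (2 * (γ - 1)) + (p : ℝ) ^ (2 * γ - 1) / (1 - γ) := by
  have hp1 : 1 ≤ p := by omega
  have hp0 : (0 : ℝ) < p := by exact_mod_cast hp1
  have ha0 := recipCoeff_nonneg h0 h1 hp1
  have hap : recipCoeff γ p p ≤ (p : ℝ) ^ (γ - 1) := by
    refine (recipCoeff_le h0 h1 hp1 p).trans ?_
    exact Real.rpow_le_rpow_of_nonpos hp0 (by linarith) (by linarith)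
  calc ∑ m ∈ range n, recipCoeff γ p m ^ 2
      ≤ ∑ m ∈ range n, ((if m < p then recipCoeff γ p m ^ 2 else 0)
          + recipCoeff γ p p * recipCoeff γ p m) := by
        refine Finset.sum_le_sum fun m _ => ?_
        have := ha0 m
        have := ha0 p
        split_ifs with h
        · exact le_add_of_nonneg_right (by positivity)
        · rw [zero_add, sq]
          exact mul_le_mul_of_nonneg_right (recipCoeff_antitone h0 h1 hp1 (by omega)) (ha0 m)
    _ ≤ ∑ m ∈ range p, recipCoeff γ p m ^ 2
          + (p : ℝ) ^ (γ - 1) * ((p : ℝ) ^ γ / (1 - γ)) := by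
        rw [Finset.sum_add_distrib, ← Finset.sum_filter, ← Finset.mul_sum]
        refine add_le_add ?_ ?_
        · refine Finset.sum_le_sum_of_subset_of_nonneg ?_ fun m _ _ => sq_nonneg _
          intro m hm
          exact Finset.mem_range.mpr (Finset.mem_filter.mp hm).2
        · exact mul_le_mul hap
            ((sum_recipCoeff_le h0 h1 hp1 n).trans (inv_bCoeff_pred_le h0 h1 hp))
            (Finset.sum_nonneg fun m _ => ha0 m) (by positivity)
    _ ≤ _ := by
        refine add_le_add (sum_recipCoeff_sq_le h0 h1 hp1 p) (le_of_eq ?_)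
        rw [← mul_div_assoc, ← Real.rpow_add hp0]
        congr 2
        ring

/-! ### The three regimes of γ -/

theorem rmse_le_of_bounds {γ : ℝ} (h0 : 0 < γ) (h1 : γ < 1) {p n k b : ℕ} (hp : 2 ≤ p)
    (hn : 1 ≤ n) (hb : 1 ≤ b) (d : ℕ) {A2 B2 : ℝ}
    (hA : ∑ m ∈ range n, recipCoeff γ p m ^ 2 ≤ A2)
    (hB : ∑ m ∈ range p, bCoeff γ m ^ 2 ≤ B2) :
    rmse d k b (factorB γ p n) (strategyC γ p n) ≤
      2 * (√k * √(A2 * B2) + √((n : ℝ) * k / b)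
        + √((k : ℝ) / b) * (√B2 * ((p : ℝ) ^ γ / (1 - γ)))
        + √((n : ℝ) * k) * (√A2 * (2 * (1 - γ) * (p : ℝ) ^ (-γ)))) := by
  refine (rmse_le h0 h1 (by omega) hn hb d hA hB).trans ?_
  have e1 := inv_bCoeff_pred_le h0 h1 hp
  have e2 := bCoeff_pred_le h0 h1 hp
  rw [div_eq_mul_one_div (√B2)]
  gcongr

theorem rmse_le_of_lt_half {γ : ℝ} {n p k b : ℕ} (d : ℕ) (h0 : 0 < γ) (hγ : γ < 1 / 2)
    (hp : 2 ≤ p) (hpn : p ≤ n) (hb : 1 ≤ b) :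
    rmse d k b (factorB γ p n) (strategyC γ p n) ≤
      10 * (√(k : ℝ) * (p : ℝ) ^ (1 / 2 - γ) / (1 / 2 - γ)
        + 1 / γ * √((n : ℝ) * k / b)
        + √((k : ℝ) * p / (γ * (1 / 2 - γ) * b))
        + (p : ℝ) ^ (-γ) * √((n : ℝ) * k / (1 / 2 - γ))) := by
  have h1 : γ < 1 := by linarith
  have hp0 : (0 : ℝ) < p := by exact_mod_cast (by omega : 0 < p)
  have hb0 : (0 : ℝ) < b := by exact_mod_cast hb
  obtain ⟨δ, hδ⟩ : ∃ δ, δ = 1 / 2 - γ := ⟨_, rfl⟩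
  have hδ0 : 0 < δ := by linarith
  have hA : ∑ m ∈ range n, recipCoeff γ p m ^ 2 ≤ 1 / δ := by
    refine (sum_recipCoeff_sq_le h0 h1 (by omega) n).trans ?_
    have h := sum_rpow_neg_le (t := 2 * δ) (by linarith) n
    have e : 2 * (γ - 1) = -(1 + 2 * δ) := by rw [hδ]; ring
    rw [e]
    refine h.trans ?_
    rw [← sub_nonneg]
    -- The difference is nonnegative because δ ≤ 1/2.
    have e2 : 1 / δ - (1 + 1 / (2 * δ)) = (1 / 2 - δ) / δ := by field_simp; ring
    rw [e2]
    exact div_nonneg (by linarith) hδ0.le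
  have hB : ∑ m ∈ range p, bCoeff γ m ^ 2 ≤ ((p : ℝ) ^ δ) ^ 2 / δ := by
    refine (sum_bCoeff_sq_le h0 h1 p).trans ?_
    have h := sum_rpow_sub_one_le (u := 2 * δ) (by linarith) (by linarith) p
    have e : 2 * (-γ) = 2 * δ - 1 := by rw [hδ]; ring
    have e3 : (p : ℝ) ^ (2 * δ) = ((p : ℝ) ^ δ) ^ 2 := by
      rw [← Real.rpow_natCast, ← Real.rpow_mul hp0.le, mul_comm]; norm_num
    rw [e]
    refine h.trans ?_
    rw [e3]
    gcongr
    linarith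
  refine (rmse_le_of_bounds h0 h1 hp (by omega) hb d hA hB).trans ?_
  rw [← hδ]
  have t1 : √k * √(1 / δ * (((p : ℝ) ^ δ) ^ 2 / δ)) = √k * (p : ℝ) ^ δ / δ := by
    have : 1 / δ * (((p : ℝ) ^ δ) ^ 2 / δ) = ((p : ℝ) ^ δ / δ) ^ 2 := by field_simp
    rw [this, Real.sqrt_sq (by positivity), mul_div_assoc]
  have t2 : √((n : ℝ) * k / b) ≤ 1 / γ * √((n : ℝ) * k / b) := by
    refine le_mul_of_one_le_left (Real.sqrt_nonneg _) ?_
    rw [le_div_iff₀ h0]; linarith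
  have t3 : √((k : ℝ) / b) * (√(((p : ℝ) ^ δ) ^ 2 / δ) * ((p : ℝ) ^ γ / (1 - γ)))
      ≤ 2 * √((k : ℝ) * p / (γ * δ * b)) := by
    have e1 : (p : ℝ) ^ γ / (1 - γ) ≤ 2 * (p : ℝ) ^ γ := by
      rw [div_le_iff₀ (by linarith)]
      have : 0 < (p : ℝ) ^ γ := by positivity
      nlinarith
    have e2 : √((p : ℝ)) = (p : ℝ) ^ δ * (p : ℝ) ^ γ := by
      rw [Real.sqrt_eq_rpow, ← Real.rpow_add hp0]; congr 1; rw [hδ]; ring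
    have e3 : √((k : ℝ) / b) * (√(((p : ℝ) ^ δ) ^ 2 / δ) * (2 * (p : ℝ) ^ γ))
        = 2 * √((k : ℝ) * p / (δ * b)) := by
      rw [Real.sqrt_div (by positivity), Real.sqrt_div (by positivity),
        Real.sqrt_sq (by positivity), Real.sqrt_div (by positivity), Real.sqrt_mul (by positivity),
        Real.sqrt_mul hδ0.le, e2]
      have := Real.sqrt_pos.mpr hδ0
      have := Real.sqrt_pos.mpr hb0
      field_simp
    calc _ ≤ √((k : ℝ) / b) * (√(((p : ℝ) ^ δ) ^ 2 / δ) * (2 * (p : ℝ) ^ γ)) := by gcongr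
      _ = 2 * √((k : ℝ) * p / (δ * b)) := e3
      _ ≤ _ := by
        gcongr
        exact mul_le_of_le_one_left hδ0.le h1.le
  have t4 : √((n : ℝ) * k) * (√(1 / δ) * (2 * (1 - γ) * (p : ℝ) ^ (-γ)))
      ≤ 2 * ((p : ℝ) ^ (-γ) * √((n : ℝ) * k / δ)) := by
    have e : √((n : ℝ) * k / δ) = √((n : ℝ) * k) * √(1 / δ) := by
      rw [← Real.sqrt_mul (by positivity), mul_one_div]
    have hq : 0 ≤ √((n : ℝ) * k) * √(1 / δ) * (p : ℝ) ^ (-γ) := by positivity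
    rw [e]
    nlinarith
  have n1 : 0 ≤ √k * (p : ℝ) ^ δ / δ := by positivity
  have n2 := Real.sqrt_nonneg ((n : ℝ) * k / b)
  have n3 := Real.sqrt_nonneg ((k : ℝ) * p / (γ * δ * b))
  have n4 : 0 ≤ (p : ℝ) ^ (-γ) * √((n : ℝ) * k / δ) := by positivity
  rw [t1]
  linarith

theorem rmse_le_of_eq_half {n p k b : ℕ} (d : ℕ) (hp : 2 ≤ p) (hpn : p ≤ n) (hb : 1 ≤ b) :
    rmse d k b (factorB (1 / 2) p n) (strategyC (1 / 2) p n) ≤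
      10 * (√(k : ℝ) * Real.log p
        + √((n : ℝ) * k / b)
        + √((k : ℝ) * p * Real.log p / b)
        + √((n : ℝ) * k * Real.log p / p)) := by
  have h0 : (0 : ℝ) < 1 / 2 := by norm_num
  have h1 : (1 / 2 : ℝ) < 1 := by norm_num
  have hp0 : (0 : ℝ) < p := by exact_mod_cast (by omega : 0 < p)
  have hb0 : (0 : ℝ) < b := by exact_mod_cast hb
  -- The threshold 2/3 is what absorbs the additive 2 in 3 log p + 2 ≤ 6 log p.
  have hlog : 2 / 3 ≤ Real.log p := by
    have := Real.log_le_log (by norm_num) (by exact_mod_cast hp : (2 : ℝ) ≤ p)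
    have := Real.log_two_gt_d9
    linarith
  obtain ⟨l, hl⟩ : ∃ l, l = Real.log p := ⟨_, rfl⟩
  have hA : ∑ m ∈ range n, recipCoeff (1 / 2) p m ^ 2 ≤ 6 * l := by
    refine (sum_recipCoeff_sq_le_add h0 h1 hp n).trans ?_
    have := sum_inv_le hp
    norm_num at this ⊢
    linarith
  have hB : ∑ m ∈ range p, bCoeff (1 / 2) m ^ 2 ≤ 3 * l := by
    refine (sum_bCoeff_sq_le h0 h1 p).trans ?_
    have := sum_inv_le hp
    norm_num at this ⊢
    linarith
  rw [← hl] at hlog ⊢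
  have hl0 : 0 < l := by linarith
  refine (rmse_le_of_bounds h0 h1 hp (by omega) hb d hA hB).trans ?_
  have hsl := Real.sqrt_nonneg l
  have s3 : √(3 : ℝ) ≤ 2 := by rw [Real.sqrt_le_iff]; norm_num
  have s6 : √(6 : ℝ) ≤ 3 := by rw [Real.sqrt_le_iff]; norm_num
  have t1 : √k * √(6 * l * (3 * l)) ≤ 5 * (√k * l) := by
    have : √(6 * l * (3 * l)) ≤ 5 * l := by
      rw [Real.sqrt_le_iff]
      exact ⟨by positivity, by nlinarith [sq_nonneg l]⟩
    nlinarith [Real.sqrt_nonneg (k : ℝ)]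
  have t3 : √((k : ℝ) / b) * (√(3 * l) * ((p : ℝ) ^ (1 / 2 : ℝ) / (1 - 1 / 2)))
      ≤ 4 * √((k : ℝ) * p * l / b) := by
    have e : √((k : ℝ) * p * l / b) = √((k : ℝ) / b) * √l * √p := by
      rw [← Real.sqrt_mul (by positivity), ← Real.sqrt_mul (by positivity)]
      congr 1; ring
    rw [e, ← Real.sqrt_eq_rpow, Real.sqrt_mul (by norm_num : (0 : ℝ) ≤ 3)]
    have hq : 0 ≤ √((k : ℝ) / b) * √l * √p := by positivity
    calc _ = 2 * √3 * (√((k : ℝ) / b) * √l * √p) := by ring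
      _ ≤ 4 * (√((k : ℝ) / b) * √l * √p) := by nlinarith
  have t4 : √((n : ℝ) * k) * (√(6 * l) * (2 * (1 - 1 / 2) * (p : ℝ) ^ (-(1 / 2) : ℝ)))
      ≤ 3 * √((n : ℝ) * k * l / p) := by
    have e : √((n : ℝ) * k * l / p) = √((n : ℝ) * k) * √l * (√p)⁻¹ := by
      rw [Real.sqrt_div (by positivity), Real.sqrt_mul (by positivity), div_eq_mul_inv]
    rw [e, Real.rpow_neg hp0.le, ← Real.sqrt_eq_rpow, Real.sqrt_mul (by norm_num : (0 : ℝ) ≤ 6)]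
    have hq : 0 ≤ √((n : ℝ) * k) * √l * (√p)⁻¹ := by positivity
    calc _ = √6 * (√((n : ℝ) * k) * √l * (√p)⁻¹) := by ring
      _ ≤ 3 * (√((n : ℝ) * k) * √l * (√p)⁻¹) := by nlinarith
  have n2 := Real.sqrt_nonneg ((n : ℝ) * k / b)
  have n3 := Real.sqrt_nonneg ((k : ℝ) * p * l / b)
  have n4 := Real.sqrt_nonneg ((n : ℝ) * k * l / p)
  linarith

theorem rmse_le_of_half_lt {γ : ℝ} {n p k b : ℕ} (d : ℕ) (hγ : 1 / 2 < γ) (h1 : γ < 1)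
    (hp : 2 ≤ p) (hpn : p ≤ n) (hb : 1 ≤ b) :
    rmse d k b (factorB γ p n) (strategyC γ p n) ≤
      10 * (√(k : ℝ) * (p : ℝ) ^ (γ - 1 / 2) / ((γ - 1 / 2) * √(1 - γ))
        + √((n : ℝ) * k / b)
        + √(k : ℝ) * (p : ℝ) ^ γ / ((1 - γ) * √((γ - 1 / 2) * b))
        + √((1 - γ) * n * k / ((γ - 1 / 2) * p))) := by
  have h0 : 0 < γ := by linarith
  have hp0 : (0 : ℝ) < p := by exact_mod_cast (by omega : 0 < p)
  have hb0 : (0 : ℝ) < b := by exact_mod_cast hb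
  obtain ⟨δ, hδ⟩ : ∃ δ, δ = γ - 1 / 2 := ⟨_, rfl⟩
  obtain ⟨ε, hε⟩ : ∃ ε, ε = 1 - γ := ⟨_, rfl⟩
  have hδ0 : 0 < δ := by linarith
  have hε0 : 0 < ε := by linarith
  have e0 : (p : ℝ) ^ (2 * δ) = ((p : ℝ) ^ δ) ^ 2 := by
    rw [← Real.rpow_natCast, ← Real.rpow_mul hp0.le, mul_comm]; norm_num
  have hB : ∑ m ∈ range p, bCoeff γ m ^ 2 ≤ 1 / δ := by
    refine (sum_bCoeff_sq_le h0 h1 p).trans ?_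
    have h := sum_rpow_neg_le (t := 2 * δ) (by linarith) p
    have e : 2 * (-γ) = -(1 + 2 * δ) := by rw [hδ]; ring
    rw [e]
    refine h.trans ?_
    rw [← sub_nonneg]
    have e2 : 1 / δ - (1 + 1 / (2 * δ)) = (1 / 2 - δ) / δ := by field_simp; ring
    rw [e2]
    exact div_nonneg (by linarith) hδ0.le
  have hA : ∑ m ∈ range n, recipCoeff γ p m ^ 2 ≤ ((p : ℝ) ^ δ) ^ 2 / (δ * ε) := by
    refine (sum_recipCoeff_sq_le_add h0 h1 hp n).trans ?_
    have h := sum_rpow_sub_one_le (u := 2 * δ) (by linarith) (by linarith) p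
    have e : 2 * (γ - 1) = 2 * δ - 1 := by rw [hδ]; ring
    have e3 : 2 * γ - 1 = 2 * δ := by rw [hδ]; ring
    rw [e, e3, ← hε]
    refine (add_le_add h le_rfl).trans ?_
    rw [e0, ← sub_nonneg]
    -- Since δ + ε = 1/2, the factor 1 - ε/2 - δ is positive.
    have e2 : ((p : ℝ) ^ δ) ^ 2 / (δ * ε) - (((p : ℝ) ^ δ) ^ 2 / (2 * δ) + ((p : ℝ) ^ δ) ^ 2 / ε)
        = ((p : ℝ) ^ δ) ^ 2 * (1 - ε / 2 - δ) / (δ * ε) := by field_simp; ring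
    rw [e2]
    exact div_nonneg (mul_nonneg (sq_nonneg _) (by linarith)) (by positivity)
  refine (rmse_le_of_bounds h0 h1 hp (by omega) hb d hA hB).trans ?_
  rw [← hδ, ← hε]
  have sδ := Real.sqrt_pos.mpr hδ0
  have sε := Real.sqrt_pos.mpr hε0
  have sb := Real.sqrt_pos.mpr hb0
  have sp := Real.sqrt_pos.mpr hp0
  have t1 : √k * √(((p : ℝ) ^ δ) ^ 2 / (δ * ε) * (1 / δ)) = √k * (p : ℝ) ^ δ / (δ * √ε) := by
    have : ((p : ℝ) ^ δ) ^ 2 / (δ * ε) * (1 / δ) = ((p : ℝ) ^ δ / δ) ^ 2 / ε := by field_simp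
    rw [this, Real.sqrt_div (by positivity), Real.sqrt_sq (by positivity)]
    field_simp
  have t3 : √((k : ℝ) / b) * (√(1 / δ) * ((p : ℝ) ^ γ / ε))
      = √k * (p : ℝ) ^ γ / (ε * √(δ * b)) := by
    rw [Real.sqrt_div (by positivity), Real.sqrt_div zero_le_one, Real.sqrt_one,
      Real.sqrt_mul hδ0.le]
    field_simp
  have t4 : √((n : ℝ) * k) * (√(((p : ℝ) ^ δ) ^ 2 / (δ * ε)) * (2 * ε * (p : ℝ) ^ (-γ)))
      = 2 * √(ε * n * k / (δ * p)) := by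
    -- As δ - γ = -1/2, the power of `p` from √A2 combines with p^(-γ) into 1/√p.
    have e1 : (p : ℝ) ^ (-γ) = ((p : ℝ) ^ δ)⁻¹ * (√p)⁻¹ := by
      rw [Real.sqrt_eq_rpow, ← Real.rpow_neg hp0.le, ← Real.rpow_neg hp0.le, ← Real.rpow_add hp0]
      congr 1; rw [hδ]; ring
    have e2 : (0 : ℝ) < (p : ℝ) ^ δ := by positivity
    rw [Real.sqrt_div (by positivity), Real.sqrt_sq (by positivity), Real.sqrt_mul hδ0.le,
      Real.sqrt_div (by positivity), mul_assoc ε, Real.sqrt_mul hε0.le, Real.sqrt_mul hδ0.le, e1]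
    field_simp
    rw [Real.sq_sqrt hε0.le]
  have n1 : 0 ≤ √k * (p : ℝ) ^ δ / (δ * √ε) := by positivity
  have n2 := Real.sqrt_nonneg ((n : ℝ) * k / b)
  have n3 : 0 ≤ √k * (p : ℝ) ^ γ / (ε * √(δ * b)) := by positivity
  have n4 := Real.sqrt_nonneg (ε * n * k / (δ * p))
  rw [t1, t3, t4]
  linarith

end BIFR

theorem corollaryC10 :
    ∃ K : ℝ, 0 < K ∧
      ∀ (γ : ℝ) (n p k b d : ℕ), 0 < γ → γ < 1 → 2 ≤ p → p ≤ n →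
        1 ≤ b → 1 ≤ k → (k : ℝ) ≤ (n : ℝ) / (b : ℝ) →
        (γ < 1 / 2 →
          BIFR.rmse d k b (BIFR.factorB γ p n) (BIFR.strategyC γ p n) ≤
            K * (√(k : ℝ) * (p : ℝ) ^ (1 / 2 - γ) / (1 / 2 - γ)
              + 1 / γ * √((n : ℝ) * k / b)
              + √((k : ℝ) * p / (γ * (1 / 2 - γ) * b))
              + (p : ℝ) ^ (-γ) * √((n : ℝ) * k / (1 / 2 - γ)))) ∧
        (γ = 1 / 2 →
          BIFR.rmse d k b (BIFR.factorB γ p n) (BIFR.strategyC γ p n) ≤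
            K * (√(k : ℝ) * Real.log p
              + √((n : ℝ) * k / b)
              + √((k : ℝ) * p * Real.log p / b)
              + √((n : ℝ) * k * Real.log p / p))) ∧
        (1 / 2 < γ →
          BIFR.rmse d k b (BIFR.factorB γ p n) (BIFR.strategyC γ p n) ≤
            K * (√(k : ℝ) * (p : ℝ) ^ (γ - 1 / 2) / ((γ - 1 / 2) * √(1 - γ))
              + √((n : ℝ) * k / b)
              + √(k : ℝ) * (p : ℝ) ^ γ / ((1 - γ) * √((γ - 1 / 2) * b))
              + √((1 - γ) * n * k / ((γ - 1 / 2) * p)))) := by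
  -- The largest constant arises at γ = 1/2: the overall factor 2 times √(6 · 3) ≤ 5.
  refine ⟨10, by norm_num, ?_⟩
  intro γ n p k b d h0 h1 hp hpn hb _ _
  refine ⟨fun h => BIFR.rmse_le_of_lt_half d h0 h hp hpn hb, ?_,
    fun h => BIFR.rmse_le_of_half_lt d h h1 hp hpn hb⟩
  rintro rfl
  exact BIFR.rmse_le_of_eq_half d hp hpn hb
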